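/- Let $d\ge 2$ and let $\mathbb{E}^d$ be Euclidean $d$-space. A convex body is a compact convex subset of $\mathbb{E}^d$ with nonempty interior. For a bounded nonempty set $K$ and a hyperplane $H$, let $w(K,H)$ be the distance between the two supporting hyperplanes of $K$ parallel to $H$. For convex bodies $K,C$ put $w_C(K)=\min_H \frac{w(K,H)}{w(C,H)}$, the minimum being over all hyperplanes $H$; let the $C$-inradius $r$ of $K$ be the largest $\rho>0$ such that some translate of $\rho C$ is contained in $K$; and for $0<\rho\le r$ let $K^{\rho C}$ be the union of all translates of $\rho C$ contained in $K$. For an integer $m\ge 1$, the $m$th successive $C$-inradius $r_C(K,m)$ of $K$ is the unique $\rho\in(0,r]$ with $w_C(K^{\rho C})=m\rho$. A convex partition $V_1\cup\dots\cup V_n$ of $\mathbb{E}^d$ is a family of closed convex sets with nonempty, pairwise disjoint interiors whose union is $\mathbb{E}^d$. The partition into the single part $V_1=\mathbb{E}^d$ is inductive; for $n\ge 2$, a convex partition $V_1\cup\dots\cup V_n$ is inductive if for every $1\le i\le n$ there is an inductive partition $W_1\cup\dots\cup W_{i-1}\cup W_{i+1}\cup\dots\cup W_n$ of $\mathbb{E}^d$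 such that $V_j\subseteq W_j$ for all $j\ne i$. **Theorem.** Let $K$ and $C$ be convex bodies in $\mathbb{E}^d$, $d\ge 2$, let $m$ be a positive integer, and let $V_1\cup\dots\cup V_n$ be an inductive partition of $\mathbb{E}^d$ such that $\operatorname{int}(V_i\cap K)\ne\emptyset$ for all $1\le i\le n$. Then the numbers $r_C(K,m)$ and $r_C(V_i\cap K,m)$, $1\le i\le n$, are well defined (the number $\rho$ in the definition exists and is unique), and $$\sum_{i=1}^{n} r_C(V_i\cap K,m)\ \ge\ r_C(K,m).$$ -/

import Mathlib

open scoped Pointwise RealInnerProductSpace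

noncomputable section

/-- A convex body of Euclidean `d`-space: a compact convex set with nonempty interior. -/
structure IsConvexBody {d : ℕ} (K : Set (EuclideanSpace ℝ (Fin d))) : Prop where
  convex : Convex ℝ K
  isCompact : IsCompact K
  interior_nonempty : (interior K).Nonempty

/-- The width of `K` parallel to the hyperplanes with unit normal `u`: the distance between the
two supporting hyperplanes `⟪u, x⟫ = max` and `⟪u, x⟫ = min` of `K`. -/
def widthAlong {d : ℕ} (K : Set (EuclideanSpace ℝ (Fin d))) (u : EuclideanSpace ℝ (Fin d)) : ℝ :=
  sSup ((fun x => ⟪u, x⟫) '' K) - sInf ((fun x => ⟪u, x⟫) '' K)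

/-- The minimal `C`-width of `K`: the minimum of the relative widths `w(K, H) / w(C, H)` over all
hyperplanes `H`, each `H` being given, up to parallelism, by a unit normal vector. -/
def minRelWidth {d : ℕ} (C K : Set (EuclideanSpace ℝ (Fin d))) : ℝ :=
  ⨅ u : Metric.sphere (0 : EuclideanSpace ℝ (Fin d)) 1, widthAlong K u / widthAlong C u

/-- The `C`-inradius of `K`: the factor of the largest positive homothetic copy of `C` a translate
of which is contained in `K`. -/
def relInradius {d : ℕ} (C K : Set (EuclideanSpace ℝ (Fin d))) : ℝ :=
  sSup {ρ : ℝ | 0 < ρ ∧ ∃ t : EuclideanSpace ℝ (Fin d), t +ᵥ ρ • C ⊆ K}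

/-- The `ρC`-rounded body of `K`: the union of all translates of `ρC` that are contained
in `K`. -/
def roundedBody {d : ℕ} (C K : Set (EuclideanSpace ℝ (Fin d))) (ρ : ℝ) :
    Set (EuclideanSpace ℝ (Fin d)) :=
  ⋃ (t : EuclideanSpace ℝ (Fin d)) (_ : t +ᵥ ρ • C ⊆ K), t +ᵥ ρ • C

/-- `ρ` is an `m`th successive `C`-inradius of `K`: `0 < ρ`, `ρ` is at most the `C`-inradius of
`K`, and the minimal `C`-width of the `ρC`-rounded body of `K` equals `m ρ`. -/
structure IsSuccessiveInradius {d : ℕ} (C K : Set (EuclideanSpace ℝ (Fin d))) (m : ℕ) (ρ : ℝ) :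
    Prop where
  pos : 0 < ρ
  le_relInradius : ρ ≤ relInradius C K
  width_eq : minRelWidth C (roundedBody C K ρ) = m * ρ

/-- The `m`th successive `C`-inradius of `K`, i.e. the number `ρ` with
`IsSuccessiveInradius C K m ρ`. It is meaningful when there is exactly one such `ρ`. -/
def successiveInradius {d : ℕ} (C K : Set (EuclideanSpace ℝ (Fin d))) (m : ℕ) : ℝ :=
  Classical.epsilon (fun ρ : ℝ => IsSuccessiveInradius C K m ρ)

/-- A convex partition of Euclidean space: closed convex sets with nonempty, pairwise disjoint
interiors whose union is the whole space. -/
structure IsConvexPartition {d n : ℕ} (V : Fin n → Set (EuclideanSpace ℝ (Fin d))) : Prop where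
  isClosed : ∀ i, IsClosed (V i)
  convex : ∀ i, Convex ℝ (V i)
  interior_nonempty : ∀ i, (interior (V i)).Nonempty
  disjoint_interior : ∀ i j, i ≠ j → Disjoint (interior (V i)) (interior (V j))
  iUnion_eq : ⋃ i, V i = Set.univ

/-- Inductive partitions, by recursion on the number of parts. The partition into one part is
inductive. A convex partition into `n + 2` parts is inductive if for every `i` there is an inductive
partition into `n + 1` parts, indexed by the indices other than `i` (through `i.succAbove`), each
part of which contains the part of the given partition with the same index. -/
def IsInductivePartition {d : ℕ} :
    (n : ℕ) → (Fin n → Set (EuclideanSpace ℝ (Fin d))) → Prop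
  | 0, _ => False
  | 1, V => V 0 = Set.univ
  | n + 2, V => IsConvexPartition V ∧
      ∀ i : Fin (n + 2), ∃ W : Fin (n + 1) → Set (EuclideanSpace ℝ (Fin d)),
        IsInductivePartition (n + 1) W ∧ ∀ j : Fin (n + 1), V (i.succAbove j) ⊆ W j

end

/-!
The translates of `ρC` contained in `L` are indexed by the erosion of `L` by `ρC`, and the
`ρC`-rounded body of `L` is the Minkowski sum of this erosion with `ρC`, so its minimal `C`-width is
that of the erosion plus `ρ`. For a convex body `L` the minimal `C`-width of the erosion is a
concave function of `ρ ∈ [0, r]` that is positive at `0` and vanishes at the inradius `r`. Hence it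
meets the line `(m - 1)ρ` exactly once, and the `m`th successive `C`-inradius is the *largest* `ρ`
at which it is at least `(m - 1)ρ`.

In this form the successive inradius makes sense for every compact convex set: it is monotone,
translation invariant, concave with respect to Minkowski combinations, and zero on sets with empty
interior. The inequality is proved by induction on the number of parts. If `V i ∩ K` has empty
interior, the partition with one part fewer that belongs to `i` has, inside `K`, the same parts with
nonempty interior. Otherwise translate `K` along a line transversal to a hyperplane separating two
of the parts. In both directions some part of the translate eventually becomes degenerate, and it
still meets all parts at the first such moment. The parts of `K` contain the Minkowski combinations
of the parts of these two translates that bring `K` back to its place, so the inequality for `K`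
follows from the two degenerate cases by concavity.
-/

section SuccessiveInradii

open Bornology Metric Set
open scoped Topology

section Erosion

variable {E : Type*} [AddCommGroup E] [Module ℝ E] {C K L L₀ L₁ : Set E} {ρ σ : ℝ}

/-- The erosion of `L` by `ρC`: the set of all vectors that translate `ρC` into `L`. The
`ρC`-rounded body of `L` is its Minkowski sum with `ρC`. -/
def erosion (C L : Set E) (ρ : ℝ) : Set E :=
  {x | x +ᵥ ρ • C ⊆ L}

lemma mem_erosion {x : E} : x ∈ erosion C L ρ ↔ ∀ c ∈ C, x + ρ • c ∈ L := by
  change x +ᵥ ρ • C ⊆ L ↔ _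
  simp [subset_def, mem_vadd_set, mem_smul_set]

lemma erosion_mono (h : K ⊆ L) : erosion C K ρ ⊆ erosion C L ρ :=
  fun _ hx => Subset.trans hx h

lemma erosion_zero (hC : C.Nonempty) : erosion C L 0 = L := by
  obtain ⟨c, hc⟩ := hC
  ext x
  simpa only [mem_erosion, zero_smul, add_zero] using ⟨fun h => h c hc, fun h _ _ => h⟩

lemma erosion_vadd (v : E) : erosion C (v +ᵥ L) ρ = v +ᵥ erosion C L ρ := by
  ext x
  simp only [mem_erosion, mem_vadd_set_iff_neg_vadd_mem, vadd_eq_add, add_assoc]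

lemma erosion_erosion_subset : erosion C (erosion C L ρ) σ ⊆ erosion C L (ρ + σ) := by
  intro x hx
  refine mem_erosion.2 fun c hc => ?_
  rw [add_comm ρ, add_smul, ← add_assoc]
  exact mem_erosion.1 (mem_erosion.1 hx c hc) c hc

lemma smul_erosion_add_smul_erosion_subset {a b : ℝ} (h : a • L₀ + b • L₁ ⊆ L) :
    a • erosion C L₀ ρ + b • erosion C L₁ σ ⊆ erosion C L (a * ρ + b * σ) := by
  rintro _ ⟨_, ⟨x, hx, rfl⟩, _, ⟨y, hy, rfl⟩, rfl⟩
  refine mem_erosion.2 fun c hc => ?_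
  have hsum : a • x + b • y + (a * ρ + b * σ) • c = a • (x + ρ • c) + b • (y + σ • c) := by module
  exact hsum ▸ h (add_mem_add (smul_mem_smul_set (mem_erosion.1 hx c hc))
    (smul_mem_smul_set (mem_erosion.1 hy c hc)))

lemma convex_erosion (hL : Convex ℝ L) : Convex ℝ (erosion C L ρ) := by
  rw [convex_iff_pointwise_add_subset]
  intro a b ha hb hab
  have h := smul_erosion_add_smul_erosion_subset (C := C) (ρ := ρ) (σ := ρ)
    (convex_iff_pointwise_add_subset.1 hL ha hb hab)
  rwa [← add_mul, hab, one_mul] at h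

section Topology

variable [TopologicalSpace E] [IsTopologicalAddGroup E]

lemma isCompact_setOf_mem_erosion [ContinuousSMul ℝ E] [T2Space E] (hC : C.Nonempty)
    (hL : IsCompact L) {I : Set ℝ} (hI : IsCompact I) :
    IsCompact {p : ℝ × E | p.1 ∈ I ∧ p.2 ∈ erosion C L p.1} := by
  have hclosed : IsClosed {p : ℝ × E | p.1 ∈ I ∧ p.2 ∈ erosion C L p.1} := by
    simp only [mem_erosion, ofPred_and, ofPred_forall]
    exact (hI.isClosed.preimage continuous_fst).inter
      (isClosed_biInter fun c _ => hL.isClosed.preimage (by fun_prop))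
  obtain ⟨c, hc⟩ := hC
  refine ((hI.prod hL).image (f := fun p => (p.1, p.2 - p.1 • c)) (by fun_prop)).of_isClosed_subset
    hclosed ?_
  rintro ⟨ρ, x⟩ ⟨hρ, hx⟩
  exact ⟨(ρ, x + ρ • c), ⟨hρ, mem_erosion.1 hx c hc⟩, by simp⟩

lemma isCompact_erosion [ContinuousSMul ℝ E] [T2Space E] (hC : C.Nonempty) (hL : IsCompact L) :
    IsCompact (erosion C L ρ) := by
  convert (isCompact_setOf_mem_erosion hC hL (isCompact_singleton (x := ρ))).image continuous_snd
  ext x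
  simp

lemma exists_pos_erosion_nonempty (hC : IsVonNBounded ℝ C) (hL : (interior L).Nonempty) :
    ∃ ρ > 0, (erosion C L ρ).Nonempty := by
  obtain ⟨p, hp⟩ := hL
  have hU : (p + ·) ⁻¹' L ∈ 𝓝 (0 : E) :=
    (continuous_const_add p).continuousAt.preimage_mem_nhds
      (by simpa using mem_interior_iff_mem_nhds.1 hp)
  have hsmall : ∀ᶠ ρ : ℝ in 𝓝[>] 0, MapsTo (ρ • ·) C ((p + ·) ⁻¹' L) :=
    (hC hU).eventually_nhdsNE_zero.filter_mono (nhdsWithin_mono 0 fun _ h => ne_of_gt h)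
  obtain ⟨ρ, hρ, hpos⟩ := (hsmall.and self_mem_nhdsWithin).exists
  exact ⟨ρ, hpos, p, mem_erosion.2 fun c hc => hρ hc⟩

end Topology

end Erosion

section Width

variable {d : ℕ} {C S T T₀ T₁ : Set (EuclideanSpace ℝ (Fin d))} {u : EuclideanSpace ℝ (Fin d)}

lemma isBounded_inner_image (hT : IsBounded T) (u : EuclideanSpace ℝ (Fin d)) :
    IsBounded ((fun x => ⟪u, x⟫) '' T) :=
  (innerSL ℝ u).lipschitz.isBounded_image hT

lemma widthAlong_nonneg (hT : IsBounded T) : 0 ≤ widthAlong T u :=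
  sub_nonneg.2 (Real.sInf_le_sSup _ (isBounded_inner_image hT u).bddBelow
    (isBounded_inner_image hT u).bddAbove)

lemma widthAlong_mono (hS : S.Nonempty) (hT : IsBounded T) (h : S ⊆ T) :
    widthAlong S u ≤ widthAlong T u :=
  sub_le_sub
    (csSup_le_csSup (isBounded_inner_image hT u).bddAbove (hS.image _) (image_mono h))
    (csInf_le_csInf (isBounded_inner_image hT u).bddBelow (hS.image _) (image_mono h))

lemma widthAlong_singleton (x : EuclideanSpace ℝ (Fin d)) : widthAlong {x} u = 0 := by
  simp [widthAlong]

lemma widthAlong_add (hS : IsBounded S) (hSne : S.Nonempty) (hT : IsBounded T)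
    (hTne : T.Nonempty) : widthAlong (S + T) u = widthAlong S u + widthAlong T u := by
  have himage : (fun x => ⟪u, x⟫) '' (S + T) = (fun x => ⟪u, x⟫) '' S + (fun x => ⟪u, x⟫) '' T :=
    image_add (innerSL ℝ u)
  have hS' := isBounded_inner_image hS u
  have hT' := isBounded_inner_image hT u
  simp only [widthAlong, himage]
  rw [csSup_add (hSne.image _) hS'.bddAbove (hTne.image _) hT'.bddAbove,
    csInf_add (hSne.image _) hS'.bddBelow (hTne.image _) hT'.bddBelow, add_sub_add_comm]

lemma widthAlong_smul {a : ℝ} (ha : 0 ≤ a) : widthAlong (a • T) u = a * widthAlong T u := by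
  have himage : (fun x => ⟪u, x⟫) '' (a • T) = a • (fun x => ⟪u, x⟫) '' T :=
    image_smul_set (innerSL ℝ u) a T
  simp only [widthAlong, himage]
  rw [Real.sSup_smul_of_nonneg ha, Real.sInf_smul_of_nonneg ha, smul_eq_mul, smul_eq_mul, mul_sub]

lemma widthAlong_vadd (hT : IsBounded T) (hTne : T.Nonempty) (v : EuclideanSpace ℝ (Fin d)) :
    widthAlong (v +ᵥ T) u = widthAlong T u := by
  rw [← singleton_vadd, vadd_eq_add, widthAlong_add isBounded_singleton (singleton_nonempty v)
    hT hTne, widthAlong_singleton, zero_add]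

lemma inner_sub_le_widthAlong (hT : IsBounded T) {x y : EuclideanSpace ℝ (Fin d)}
    (hx : x ∈ T) (hy : y ∈ T) : ⟪u, x - y⟫ ≤ widthAlong T u := by
  rw [inner_sub_right]
  exact sub_le_sub (le_csSup (isBounded_inner_image hT u).bddAbove (mem_image_of_mem _ hx))
    (csInf_le (isBounded_inner_image hT u).bddBelow (mem_image_of_mem _ hy))

lemma exists_inner_sub_eq_widthAlong (hT : IsCompact T) (hTne : T.Nonempty)
    (u : EuclideanSpace ℝ (Fin d)) : ∃ x ∈ T, ∃ y ∈ T, ⟪u, x - y⟫ = widthAlong T u := by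
  have hcompact : IsCompact ((fun x => ⟪u, x⟫) '' T) := hT.image (by fun_prop)
  obtain ⟨x, hx, hxu⟩ := hcompact.sSup_mem (hTne.image _)
  obtain ⟨y, hy, hyu⟩ := hcompact.sInf_mem (hTne.image _)
  exact ⟨x, hx, y, hy, by rw [inner_sub_right, widthAlong, ← hxu, ← hyu]⟩

lemma widthAlong_eq_zero_iff (hT : IsBounded T) (hTne : T.Nonempty) :
    widthAlong T u = 0 ↔ u ∈ (vectorSpan ℝ T)ᗮ := by
  constructor
  · intro h
    have hle : vectorSpan ℝ T ≤ (ℝ ∙ u)ᗮ := by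
      rw [vectorSpan_def, Submodule.span_le]
      rintro _ ⟨x, hx, y, hy, rfl⟩
      have hxy := h ▸ inner_sub_le_widthAlong (u := u) hT hx hy
      have hyx := h ▸ inner_sub_le_widthAlong (u := u) hT hy hx
      rw [← neg_sub, inner_neg_right, neg_nonpos] at hyx
      exact Submodule.mem_orthogonal_singleton_iff_inner_right.2 (hxy.antisymm hyx)
    exact Submodule.orthogonal_le hle
      (Submodule.le_orthogonal_orthogonal _ (Submodule.mem_span_singleton_self u))
  · intro hu
    obtain ⟨x, hx⟩ := hTne
    have himage : (fun y => ⟪u, y⟫) '' T = {⟪u, x⟫} := by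
      refine (Set.Nonempty.image _ ⟨x, hx⟩).subset_singleton_iff.1 ?_
      rintro _ ⟨y, hy, rfl⟩
      have hyx := Submodule.inner_left_of_mem_orthogonal (vsub_mem_vectorSpan ℝ hy hx) hu
      rwa [vsub_eq_sub, inner_sub_right, sub_eq_zero] at hyx
    rw [widthAlong, himage, csSup_singleton, csInf_singleton, sub_self]

lemma affineSpan_eq_top_iff_widthAlong_pos (hT : IsBounded T) (hTne : T.Nonempty) :
    affineSpan ℝ T = ⊤ ↔ ∀ u : sphere (0 : EuclideanSpace ℝ (Fin d)) 1, 0 < widthAlong T u := by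
  rw [AffineSubspace.affineSpan_eq_top_iff_vectorSpan_eq_top_of_nonempty ℝ _ _ hTne,
    ← Submodule.orthogonal_eq_bot_iff]
  constructor
  · intro hbot u
    refine (widthAlong_nonneg hT).lt_of_ne' fun h => ?_
    rw [widthAlong_eq_zero_iff hT hTne, hbot, Submodule.mem_bot] at h
    exact ne_zero_of_mem_unit_sphere u h
  · intro hpos
    refine (Submodule.eq_bot_iff _).2 fun v hv => by_contra fun hv0 => ?_
    have hunit : ‖v‖⁻¹ • v ∈ sphere (0 : EuclideanSpace ℝ (Fin d)) 1 := by
      simpa using norm_smul_inv_norm (𝕜 := ℝ) hv0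
    exact (hpos ⟨_, hunit⟩).ne'
      ((widthAlong_eq_zero_iff hT hTne).2 (Submodule.smul_mem _ _ hv))

lemma minRelWidth_nonneg (hC : IsBounded C) (hT : IsBounded T) : 0 ≤ minRelWidth C T :=
  Real.iInf_nonneg fun _ => div_nonneg (widthAlong_nonneg hT) (widthAlong_nonneg hC)

section SpanningGauge

variable [NeZero d] (hC : IsBounded C) (hspan : affineSpan ℝ C = ⊤)
include hC hspan

lemma le_minRelWidth_iff (hT : IsBounded T) {s : ℝ} :
    s ≤ minRelWidth C T ↔
      ∀ u : sphere (0 : EuclideanSpace ℝ (Fin d)) 1, s * widthAlong C u ≤ widthAlong T u := by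
  have hpos := (affineSpan_eq_top_iff_widthAlong_pos hC
    (AffineSubspace.nonempty_of_affineSpan_eq_top ℝ _ _ hspan)).1 hspan
  have hbdd : BddBelow (range fun u : sphere (0 : EuclideanSpace ℝ (Fin d)) 1 =>
      widthAlong T u / widthAlong C u) :=
    ⟨0, by rintro _ ⟨u, rfl⟩; exact div_nonneg (widthAlong_nonneg hT) (hpos u).le⟩
  have : Nonempty (sphere (0 : EuclideanSpace ℝ (Fin d)) 1) :=
    (NormedSpace.sphere_nonempty.2 zero_le_one).to_subtype
  rw [minRelWidth, le_ciInf_iff hbdd]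
  exact forall_congr' fun u => le_div_iff₀ (hpos u)

lemma minRelWidth_mul_widthAlong_le (hT : IsBounded T)
    (u : sphere (0 : EuclideanSpace ℝ (Fin d)) 1) :
    minRelWidth C T * widthAlong C u ≤ widthAlong T u :=
  (le_minRelWidth_iff hC hspan hT).1 le_rfl u

lemma minRelWidth_mono (hS : S.Nonempty) (hT : IsBounded T) (h : S ⊆ T) :
    minRelWidth C S ≤ minRelWidth C T :=
  (le_minRelWidth_iff hC hspan hT).2 fun u =>
    (minRelWidth_mul_widthAlong_le hC hspan (hT.subset h) u).trans (widthAlong_mono hS hT h)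

lemma add_le_minRelWidth_add (hT₀ : IsBounded T₀) (hT₀ne : T₀.Nonempty) (hT₁ : IsBounded T₁)
    (hT₁ne : T₁.Nonempty) {a b : ℝ} (ha : 0 ≤ a) (hb : 0 ≤ b) :
    a * minRelWidth C T₀ + b * minRelWidth C T₁ ≤ minRelWidth C (a • T₀ + b • T₁) := by
  refine (le_minRelWidth_iff hC hspan ((hT₀.smul₀ a).add (hT₁.smul₀ b))).2 fun u => ?_
  rw [widthAlong_add (hT₀.smul₀ a) hT₀ne.smul_set (hT₁.smul₀ b) hT₁ne.smul_set,
    widthAlong_smul ha, widthAlong_smul hb, add_mul, mul_assoc, mul_assoc]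
  gcongr <;> exact minRelWidth_mul_widthAlong_le hC hspan ‹_› u

lemma minRelWidth_add_smul (hT : IsBounded T) (hTne : T.Nonempty) {ρ : ℝ} (hρ : 0 ≤ ρ) :
    minRelWidth C (T + ρ • C) = minRelWidth C T + ρ := by
  have hCne := AffineSubspace.nonempty_of_affineSpan_eq_top ℝ _ _ hspan
  refine eq_of_forall_le_iff fun s => ?_
  rw [← sub_le_iff_le_add, le_minRelWidth_iff hC hspan (hT.add (hC.smul₀ ρ)),
    le_minRelWidth_iff hC hspan hT]
  refine forall_congr' fun u => ?_
  rw [widthAlong_add hT hTne (hC.smul₀ ρ) hCne.smul_set, widthAlong_smul hρ, sub_mul,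
    sub_le_iff_le_add]

lemma le_minRelWidth_of_erosion_nonempty (hT : IsBounded T) {ρ : ℝ} (hρ : 0 ≤ ρ)
    (hne : (erosion C T ρ).Nonempty) : ρ ≤ minRelWidth C T := by
  have hCne := AffineSubspace.nonempty_of_affineSpan_eq_top ℝ _ _ hspan
  obtain ⟨x, hx⟩ := hne
  refine (le_minRelWidth_iff hC hspan hT).2 fun u => ?_
  calc ρ * widthAlong C u = widthAlong (x +ᵥ ρ • C) u := by
        rw [widthAlong_vadd (hC.smul₀ ρ) hCne.smul_set, widthAlong_smul hρ]
    _ ≤ widthAlong T u := widthAlong_mono hCne.smul_set.vadd_set hT hx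

lemma interior_nonempty_of_minRelWidth_pos (hT : IsBounded T) (hTne : T.Nonempty)
    (hTconv : Convex ℝ T) (hpos : 0 < minRelWidth C T) : (interior T).Nonempty := by
  have hCne := AffineSubspace.nonempty_of_affineSpan_eq_top ℝ _ _ hspan
  rw [hTconv.interior_nonempty_iff_affineSpan_eq_top, affineSpan_eq_top_iff_widthAlong_pos hT hTne]
  exact fun u => (mul_pos hpos ((affineSpan_eq_top_iff_widthAlong_pos hC hCne).1 hspan u)).trans_le
    (minRelWidth_mul_widthAlong_le hC hspan hT u)

end SpanningGauge

end Width

section RoundingFactors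

variable {d : ℕ} {C L L₀ L₁ : Set (EuclideanSpace ℝ (Fin d))} {k : ℝ}

/-- The factors `ρ ≥ 0` such that some translate of `ρC` is contained in `L` and the minimal
`C`-width of the erosion of `L` by `ρC` is at least `kρ`. As the `ρC`-rounded body of `L` exceeds
the erosion by `ρ` in minimal `C`-width, `k = m - 1` gives the condition `w_C(L^{ρC}) ≥ mρ`. -/
def roundingFactors (C L : Set (EuclideanSpace ℝ (Fin d))) (k : ℝ) : Set ℝ :=
  {ρ | 0 ≤ ρ ∧ (erosion C L ρ).Nonempty ∧ k * ρ ≤ minRelWidth C (erosion C L ρ)}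

/-- The largest rounding factor of `L`. For a convex body `L` and `k = m - 1` it is the `m`th
successive `C`-inradius, and for a compact convex `L` with empty interior it is `0`. -/
noncomputable def maxRoundingFactor (C L : Set (EuclideanSpace ℝ (Fin d))) (k : ℝ) : ℝ :=
  sSup (roundingFactors C L k)

lemma isCompact_setOf_le_widthAlong_erosion (hC : C.Nonempty) (hL : IsCompact L) {I : Set ℝ}
    (hI : IsCompact I) (k : ℝ) (u : EuclideanSpace ℝ (Fin d)) :
    IsCompact {ρ ∈ I | (erosion C L ρ).Nonempty ∧ k * ρ ≤ widthAlong (erosion C L ρ) u} := by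
  have hgraph := isCompact_setOf_mem_erosion hC hL hI
  have hclosed : IsClosed {q : (ℝ × EuclideanSpace ℝ (Fin d)) × (ℝ × EuclideanSpace ℝ (Fin d)) |
      q.1.1 = q.2.1 ∧ k * q.1.1 ≤ ⟪u, q.1.2 - q.2.2⟫} := by
    rw [ofPred_and]
    exact (isClosed_eq (by fun_prop) (by fun_prop)).inter (isClosed_le (by fun_prop) (by fun_prop))
  convert ((hgraph.prod hgraph).inter_right hclosed).image (f := fun q => q.1.1) (by fun_prop)
  ext ρ
  constructor
  · rintro ⟨hρ, hne, hle⟩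
    obtain ⟨x, hx, y, hy, hxy⟩ := exists_inner_sub_eq_widthAlong (isCompact_erosion hC hL) hne u
    exact ⟨((ρ, x), (ρ, y)), ⟨⟨⟨hρ, hx⟩, ⟨hρ, hy⟩⟩, rfl, hle.trans_eq hxy.symm⟩, rfl⟩
  · rintro ⟨⟨⟨ρ, x⟩, ⟨_, y⟩⟩, ⟨⟨⟨hρ, hx⟩, ⟨-, hy⟩⟩, hfst, hle⟩, rfl⟩
    obtain rfl : ρ = _ := hfst
    exact ⟨hρ, ⟨x, hx⟩,
      hle.trans (inner_sub_le_widthAlong (isCompact_erosion hC hL).isBounded hx hy)⟩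

lemma maxRoundingFactor_nonneg : 0 ≤ maxRoundingFactor C L k :=
  Real.sSup_nonneg fun _ hρ => hρ.1

lemma maxRoundingFactor_vadd (hC : C.Nonempty) (hL : IsCompact L)
    (v : EuclideanSpace ℝ (Fin d)) :
    maxRoundingFactor C (v +ᵥ L) k = maxRoundingFactor C L k := by
  have hfactors : roundingFactors C (v +ᵥ L) k = roundingFactors C L k := by
    ext ρ
    simp only [roundingFactors, erosion_vadd, vadd_set_nonempty, mem_ofPred_eq]
    refine and_congr_right fun _ => and_congr_right fun hne => ?_
    simp only [minRelWidth, widthAlong_vadd (isCompact_erosion hC hL).isBounded hne]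
  rw [maxRoundingFactor, hfactors, maxRoundingFactor]

variable [NeZero d] (hC : IsBounded C) (hspan : affineSpan ℝ C = ⊤)
include hC hspan

lemma isCompact_roundingFactors (hL : IsCompact L) : IsCompact (roundingFactors C L k) := by
  have hCne := AffineSubspace.nonempty_of_affineSpan_eq_top ℝ _ _ hspan
  obtain ⟨u₀⟩ : Nonempty (sphere (0 : EuclideanSpace ℝ (Fin d)) 1) :=
    (NormedSpace.sphere_nonempty.2 zero_le_one).to_subtype
  have hinter : roundingFactors C L k = ⋂ u : sphere (0 : EuclideanSpace ℝ (Fin d)) 1,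
      {ρ ∈ Icc 0 (minRelWidth C L) | (erosion C L ρ).Nonempty ∧
        k * widthAlong C u * ρ ≤ widthAlong (erosion C L ρ) u} := by
    ext ρ
    have hiff := le_minRelWidth_iff hC hspan (isCompact_erosion (ρ := ρ) hCne hL).isBounded
      (s := k * ρ)
    simp only [mul_right_comm k ρ] at hiff
    rw [mem_iInter]
    constructor
    · rintro ⟨hρ, hne, hle⟩ u
      exact ⟨⟨hρ, le_minRelWidth_of_erosion_nonempty hC hspan hL.isBounded hρ hne⟩, hne,
        hiff.1 hle u⟩
    · intro h
      obtain ⟨⟨hρ, -⟩, hne, -⟩ := h u₀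
      exact ⟨hρ, hne, hiff.2 fun u => (h u).2.2⟩
  have hcompact := fun u : sphere (0 : EuclideanSpace ℝ (Fin d)) 1 =>
    isCompact_setOf_le_widthAlong_erosion hCne hL (isCompact_Icc (a := 0) (b := minRelWidth C L))
      (k * widthAlong C u) u
  rw [hinter]
  exact (hcompact u₀).of_isClosed_subset (isClosed_iInter fun u => (hcompact u).isClosed)
    (iInter_subset _ u₀)

lemma isGreatest_maxRoundingFactor (hL : IsCompact L) (hne : L.Nonempty) :
    IsGreatest (roundingFactors C L k) (maxRoundingFactor C L k) := by
  have hCne := AffineSubspace.nonempty_of_affineSpan_eq_top ℝ _ _ hspan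
  refine (isCompact_roundingFactors hC hspan hL).isGreatest_sSup ⟨0, le_rfl, ?_, ?_⟩
  · rwa [erosion_zero hCne]
  · rw [erosion_zero hCne, mul_zero]
    exact minRelWidth_nonneg hC hL.isBounded

lemma le_maxRoundingFactor (hL : IsCompact L) {ρ : ℝ} (hρ : ρ ∈ roundingFactors C L k) :
    ρ ≤ maxRoundingFactor C L k :=
  le_csSup (isCompact_roundingFactors hC hspan hL).bddAbove hρ

lemma maxRoundingFactor_mono (hL : IsCompact L) (h : L₀ ⊆ L) :
    maxRoundingFactor C L₀ k ≤ maxRoundingFactor C L k := by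
  have hCne := AffineSubspace.nonempty_of_affineSpan_eq_top ℝ _ _ hspan
  refine Real.sSup_le (fun ρ ⟨hρ, hne, hle⟩ => ?_) maxRoundingFactor_nonneg
  have hmono : erosion C L₀ ρ ⊆ erosion C L ρ := erosion_mono h
  exact le_maxRoundingFactor hC hspan hL ⟨hρ, hne.mono hmono, hle.trans
    (minRelWidth_mono hC hspan hne (isCompact_erosion hCne hL).isBounded hmono)⟩

lemma add_le_minRelWidth_erosion (hL₀ : IsCompact L₀) (hL₁ : IsCompact L₁) (hL : IsCompact L)
    {a b ρ σ : ℝ} (ha : 0 ≤ a) (hb : 0 ≤ b) (h : a • L₀ + b • L₁ ⊆ L)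
    (hne₀ : (erosion C L₀ ρ).Nonempty) (hne₁ : (erosion C L₁ σ).Nonempty) :
    a * minRelWidth C (erosion C L₀ ρ) + b * minRelWidth C (erosion C L₁ σ) ≤
      minRelWidth C (erosion C L (a * ρ + b * σ)) := by
  have hCne := AffineSubspace.nonempty_of_affineSpan_eq_top ℝ _ _ hspan
  exact (add_le_minRelWidth_add hC hspan (isCompact_erosion hCne hL₀).isBounded hne₀
    (isCompact_erosion hCne hL₁).isBounded hne₁ ha hb).trans
    (minRelWidth_mono hC hspan (hne₀.smul_set.add hne₁.smul_set)
      (isCompact_erosion hCne hL).isBounded (smul_erosion_add_smul_erosion_subset h))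

lemma add_le_maxRoundingFactor (hL₀ : IsCompact L₀) (hne₀ : L₀.Nonempty) (hL₁ : IsCompact L₁)
    (hne₁ : L₁.Nonempty) (hL : IsCompact L) {a b : ℝ} (ha : 0 ≤ a) (hb : 0 ≤ b)
    (h : a • L₀ + b • L₁ ⊆ L) :
    a * maxRoundingFactor C L₀ k + b * maxRoundingFactor C L₁ k ≤ maxRoundingFactor C L k := by
  obtain ⟨hρ, hρne, hρle⟩ := (isGreatest_maxRoundingFactor (k := k) hC hspan hL₀ hne₀).1
  obtain ⟨hσ, hσne, hσle⟩ := (isGreatest_maxRoundingFactor (k := k) hC hspan hL₁ hne₁).1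
  refine le_maxRoundingFactor hC hspan hL ⟨by positivity,
    (hρne.smul_set.add hσne.smul_set).mono (smul_erosion_add_smul_erosion_subset h), ?_⟩
  refine le_trans ?_ (add_le_minRelWidth_erosion hC hspan hL₀ hL₁ hL ha hb h hρne hσne)
  rw [mul_add, mul_left_comm k, mul_left_comm k]
  gcongr

lemma maxRoundingFactor_eq_zero (hL : IsCompact L) (hLconv : Convex ℝ L)
    (hint : interior L = ∅) : maxRoundingFactor C L k = 0 := by
  have hCne := AffineSubspace.nonempty_of_affineSpan_eq_top ℝ _ _ hspan
  refine (Real.sSup_nonpos ?_).antisymm maxRoundingFactor_nonneg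
  rintro ρ ⟨hρ, ⟨x, hx⟩, -⟩
  by_contra! hpos
  exact (interior_nonempty_of_minRelWidth_pos hC hspan hL.isBounded
    (hCne.smul_set.vadd_set.mono hx) hLconv (hpos.trans_le
      (le_minRelWidth_of_erosion_nonempty hC hspan hL.isBounded hρ ⟨x, hx⟩))).ne_empty hint

end RoundingFactors

section SuccessiveInradius

lemma isGreatest_iff_eq_zero_of_concaveOn {a b ρ : ℝ} {h : ℝ → ℝ} (hh : ConcaveOn ℝ (Icc a b) h)
    (ha : 0 < h a) (hb : h b ≤ 0) (hρ : ρ ∈ Icc a b) :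
    IsGreatest {σ ∈ Icc a b | 0 ≤ h σ} ρ ↔ h ρ = 0 := by
  have hab : a ≤ b := hρ.1.trans hρ.2
  constructor
  · rintro ⟨⟨-, hnonneg⟩, hub⟩
    by_contra hne
    have hpos : 0 < h ρ := hnonneg.lt_of_ne' hne
    have hlt : ρ < b := hρ.2.lt_of_ne fun h => by subst h; exact hpos.not_ge hb
    -- the zero of the chord of `h` over `[ρ, b]`
    set t := h ρ / (h ρ - h b)
    have hden : 0 < h ρ - h b := by linarith
    have ht0 : 0 < t := div_pos hpos hden
    have ht1 : t ≤ 1 := (div_le_one hden).2 (by linarith)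
    have hchord : (1 - t) * h ρ + t * h b = 0 := by
      linear_combination -div_mul_cancel₀ (h ρ) hden.ne'
    have hb' : b ∈ Icc a b := right_mem_Icc.2 hab
    have hsum : 1 - t + t = 1 := sub_add_cancel 1 t
    have hmem := hh.1 hρ hb' (sub_nonneg.2 ht1) ht0.le hsum
    have hle := hub ⟨hmem, hchord.symm.trans_le (hh.2 hρ hb' (sub_nonneg.2 ht1) ht0.le hsum)⟩
    simp only [smul_eq_mul] at hle
    linarith [mul_pos ht0 (sub_pos.2 hlt)]
  · refine fun hzero => ⟨⟨hρ, hzero.ge⟩, fun σ ⟨hσ, hσnonneg⟩ => ?_⟩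
    by_contra! hlt
    have haρ : a < ρ := hρ.1.lt_of_ne fun h => by subst h; exact ha.ne' hzero
    have hneg : h σ < h ρ := hh.lt_right_of_left_lt (left_mem_Icc.2 hab) hσ
      (openSegment_eq_Ioo (haρ.trans hlt) ▸ ⟨haρ, hlt⟩) (hzero.trans_lt ha)
    exact (hneg.trans_eq hzero).not_ge hσnonneg

variable {d : ℕ} {C L : Set (EuclideanSpace ℝ (Fin d))} {m : ℕ} {ρ : ℝ}

lemma IsConvexBody.nonempty (hL : IsConvexBody L) : L.Nonempty :=
  hL.interior_nonempty.mono interior_subset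

lemma IsConvexBody.vadd (hL : IsConvexBody L) (v : EuclideanSpace ℝ (Fin d)) :
    IsConvexBody (v +ᵥ L) where
  convex := hL.convex.vadd v
  isCompact := hL.isCompact.vadd v
  interior_nonempty := by
    rw [interior_vadd]
    exact hL.interior_nonempty.vadd_set

lemma roundedBody_eq_erosion_add : roundedBody C L ρ = erosion C L ρ + ρ • C :=
  iUnion_add_left_image (s := erosion C L ρ) (t := ρ • C)

variable [NeZero d] (hC : IsBounded C) (hspan : affineSpan ℝ C = ⊤)
include hC hspan

lemma isGreatest_relInradius (hL : IsConvexBody L) :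
    IsGreatest {ρ | 0 < ρ ∧ (erosion C L ρ).Nonempty} (relInradius C L) := by
  obtain ⟨⟨-, hne, -⟩, hub⟩ :=
    isGreatest_maxRoundingFactor (k := 0) hC hspan hL.isCompact hL.nonempty
  have hmem : ∀ {σ : ℝ}, 0 ≤ σ → (erosion C L σ).Nonempty → σ ∈ roundingFactors C L 0 := by
    intro σ hσ hσne
    refine ⟨hσ, hσne, ?_⟩
    rw [zero_mul]
    exact minRelWidth_nonneg hC (isCompact_erosion
      (AffineSubspace.nonempty_of_affineSpan_eq_top ℝ _ _ hspan) hL.isCompact).isBounded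
  obtain ⟨σ, hσ, hσne⟩ := exists_pos_erosion_nonempty
    (NormedSpace.isVonNBounded_of_isBounded ℝ hC) hL.interior_nonempty
  have hgreatest : IsGreatest {ρ | 0 < ρ ∧ (erosion C L ρ).Nonempty} (maxRoundingFactor C L 0) :=
    ⟨⟨hσ.trans_le (hub (hmem hσ.le hσne)), hne⟩, fun τ hτ => hub (hmem hτ.1.le hτ.2)⟩
  have hsup : relInradius C L = maxRoundingFactor C L 0 := hgreatest.csSup_eq
  rwa [hsup]

lemma erosion_nonempty_iff_le_relInradius (hL : IsConvexBody L) (hρ : 0 ≤ ρ) :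
    (erosion C L ρ).Nonempty ↔ ρ ≤ relInradius C L := by
  obtain ⟨⟨hpos, hne⟩, hub⟩ := isGreatest_relInradius hC hspan hL
  constructor
  · intro h
    rcases hρ.eq_or_lt with rfl | hρ
    · exact hpos.le
    · exact hub ⟨hρ, h⟩
  · intro h
    have hLne : (erosion C L 0).Nonempty := by
      rw [erosion_zero (AffineSubspace.nonempty_of_affineSpan_eq_top ℝ _ _ hspan)]
      exact hL.nonempty
    obtain ⟨a, b, ha, hb, hab, rfl⟩ : ρ ∈ segment ℝ 0 (relInradius C L) :=
      (segment_eq_Icc hpos.le).symm ▸ ⟨hρ, h⟩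
    exact (hLne.smul_set.add hne.smul_set).mono (smul_erosion_add_smul_erosion_subset
      (convex_iff_pointwise_add_subset.1 hL.convex ha hb hab))

lemma concaveOn_minRelWidth_erosion (hL : IsConvexBody L) :
    ConcaveOn ℝ (Icc 0 (relInradius C L)) fun ρ => minRelWidth C (erosion C L ρ) := by
  refine ⟨convex_Icc _ _, fun ρ hρ σ hσ a b ha hb hab => ?_⟩
  exact add_le_minRelWidth_erosion hC hspan hL.isCompact hL.isCompact hL.isCompact ha hb
    (convex_iff_pointwise_add_subset.1 hL.convex ha hb hab)
    ((erosion_nonempty_iff_le_relInradius hC hspan hL hρ.1).2 hρ.2)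
    ((erosion_nonempty_iff_le_relInradius hC hspan hL hσ.1).2 hσ.2)

lemma minRelWidth_erosion_relInradius_nonpos (hL : IsConvexBody L) :
    minRelWidth C (erosion C L (relInradius C L)) ≤ 0 := by
  obtain ⟨⟨hpos, hne⟩, hub⟩ := isGreatest_relInradius hC hspan hL
  have hcompact : IsCompact (erosion C L (relInradius C L)) := isCompact_erosion
    (AffineSubspace.nonempty_of_affineSpan_eq_top ℝ _ _ hspan) hL.isCompact
  by_contra! hwidth
  obtain ⟨σ, hσ, hσne⟩ := exists_pos_erosion_nonempty
    (NormedSpace.isVonNBounded_of_isBounded ℝ hC) (interior_nonempty_of_minRelWidth_pos hC hspan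
      hcompact.isBounded hne (convex_erosion hL.convex) hwidth)
  have hle := hub ⟨add_pos hpos hσ, hσne.mono erosion_erosion_subset⟩
  linarith

lemma minRelWidth_pos (hL : IsConvexBody L) : 0 < minRelWidth C L := by
  obtain ⟨⟨hr, hne⟩, -⟩ := isGreatest_relInradius hC hspan hL
  exact hr.trans_le (le_minRelWidth_of_erosion_nonempty hC hspan hL.isCompact.isBounded hr.le hne)

lemma minRelWidth_roundedBody (hL : IsCompact L) (hρ : 0 ≤ ρ) (hne : (erosion C L ρ).Nonempty) :
    minRelWidth C (roundedBody C L ρ) = minRelWidth C (erosion C L ρ) + ρ := by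
  have hcompact : IsCompact (erosion C L ρ) := isCompact_erosion
    (AffineSubspace.nonempty_of_affineSpan_eq_top ℝ _ _ hspan) hL
  rw [roundedBody_eq_erosion_add, minRelWidth_add_smul hC hspan hcompact.isBounded hne hρ]

lemma isGreatest_roundingFactors_iff {k : ℝ} (hk : 0 ≤ k) (hL : IsConvexBody L)
    (hρ : ρ ∈ Icc 0 (relInradius C L)) :
    IsGreatest (roundingFactors C L k) ρ ↔ minRelWidth C (erosion C L ρ) = k * ρ := by
  have hCne := AffineSubspace.nonempty_of_affineSpan_eq_top ℝ _ _ hspan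
  have hr : 0 < relInradius C L := (isGreatest_relInradius hC hspan hL).1.1
  set r := relInradius C L
  set h : ℝ → ℝ := fun σ => minRelWidth C (erosion C L σ) - k * σ with h_def
  have hconcave : ConcaveOn ℝ (Icc 0 r) h :=
    (concaveOn_minRelWidth_erosion hC hspan hL).sub ((convexOn_id (convex_Icc 0 r)).smul hk)
  have hzero : 0 < h 0 := by
    simp only [h_def, erosion_zero hCne, mul_zero, sub_zero]
    exact minRelWidth_pos hC hspan hL
  have hend : h r ≤ 0 := sub_nonpos.2
    ((minRelWidth_erosion_relInradius_nonpos hC hspan hL).trans (mul_nonneg hk hr.le))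
  have hfactors : roundingFactors C L k = {σ ∈ Icc 0 r | 0 ≤ h σ} := by
    ext σ
    simp only [roundingFactors, h_def, mem_ofPred_eq, mem_Icc, sub_nonneg, and_assoc]
    exact and_congr_right fun hσ =>
      and_congr_left' (erosion_nonempty_iff_le_relInradius hC hspan hL hσ)
  rw [hfactors, isGreatest_iff_eq_zero_of_concaveOn hconcave hzero hend hρ, h_def, sub_eq_zero]

lemma isSuccessiveInradius_iff_isGreatest (hL : IsConvexBody L) (hm : 1 ≤ m) :
    IsSuccessiveInradius C L m ρ ↔ IsGreatest (roundingFactors C L (m - 1)) ρ := by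
  have hm' : (0 : ℝ) ≤ m - 1 := sub_nonneg.2 (by exact_mod_cast hm)
  have hiff : 0 ≤ ρ → ρ ≤ relInradius C L → (minRelWidth C (roundedBody C L ρ) = m * ρ ↔
      IsGreatest (roundingFactors C L (m - 1)) ρ) := by
    intro hρ hle
    rw [isGreatest_roundingFactors_iff hC hspan hm' hL ⟨hρ, hle⟩, sub_one_mul, eq_sub_iff_add_eq,
      minRelWidth_roundedBody hC hspan hL.isCompact hρ
        ((erosion_nonempty_iff_le_relInradius hC hspan hL hρ).2 hle)]
  constructor
  · rintro ⟨hpos, hle, heq⟩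
    exact (hiff hpos.le hle).1 heq
  · intro hgreatest
    obtain ⟨hρ, hne, -⟩ := hgreatest.1
    have hle := (erosion_nonempty_iff_le_relInradius hC hspan hL hρ).1 hne
    refine ⟨hρ.lt_of_ne' ?_, hle, (hiff hρ hle).2 hgreatest⟩
    rintro rfl
    have hwidth := (isGreatest_roundingFactors_iff hC hspan hm' hL ⟨hρ, hle⟩).1 hgreatest
    rw [erosion_zero (AffineSubspace.nonempty_of_affineSpan_eq_top ℝ _ _ hspan), mul_zero] at hwidth
    exact (minRelWidth_pos hC hspan hL).ne' hwidth

lemma existsUnique_isSuccessiveInradius (hL : IsConvexBody L) (hm : 1 ≤ m) :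
    ∃! ρ : ℝ, IsSuccessiveInradius C L m ρ := by
  simp only [isSuccessiveInradius_iff_isGreatest hC hspan hL hm]
  have hgreatest := isGreatest_maxRoundingFactor (k := m - 1) hC hspan hL.isCompact hL.nonempty
  exact ⟨_, hgreatest, fun _ h => h.unique hgreatest⟩

lemma successiveInradius_eq_maxRoundingFactor (hL : IsConvexBody L) (hm : 1 ≤ m) :
    successiveInradius C L m = maxRoundingFactor C L (m - 1) := by
  have hspec := Classical.epsilon_spec (existsUnique_isSuccessiveInradius hC hspan hL hm).exists
  exact ((isSuccessiveInradius_iff_isGreatest hC hspan hL hm).1 hspec).unique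
    (isGreatest_maxRoundingFactor hC hspan hL.isCompact hL.nonempty)

end SuccessiveInradius

section Slide

variable {E : Type*} [NormedAddCommGroup E] {A B G K : Set E} {x y : E}

lemma inter_vadd_nonempty_iff : (A ∩ (x +ᵥ K)).Nonempty ↔ x ∈ A - K := by
  constructor
  · rintro ⟨_, hp, p, hpK, rfl⟩
    exact ⟨x + p, hp, p, hpK, add_sub_cancel_right x p⟩
  · rintro ⟨q, hq, p, hpK, rfl⟩
    exact ⟨q, hq, p, hpK, sub_add_cancel q p⟩

lemma isOpen_setOf_interior_inter_vadd_nonempty :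
    IsOpen {x : E | (interior (A ∩ (x +ᵥ K))).Nonempty} := by
  simp only [interior_inter, interior_vadd, inter_vadd_nonempty_iff, ofPred_mem_eq]
  exact isOpen_interior.sub_right

lemma isClosed_setOf_inter_vadd_nonempty (hA : IsClosed A) (hK : IsCompact K) :
    IsClosed {x : E | (A ∩ (x +ᵥ K)).Nonempty} := by
  simp only [inter_vadd_nonempty_iff, ofPred_mem_eq, sub_eq_add_neg]
  exact hA.add_right_of_isCompact hK.neg

variable [NormedSpace ℝ E]

lemma smul_inter_vadd_add_smul_inter_vadd_subset (hA : Convex ℝ A) (hK : Convex ℝ K) {a b : ℝ}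
    (ha : 0 ≤ a) (hb : 0 ≤ b) (hab : a + b = 1) :
    a • (A ∩ (x +ᵥ K)) + b • (A ∩ (y +ᵥ K)) ⊆ A ∩ ((a • x + b • y) +ᵥ K) := by
  rintro _ ⟨_, ⟨_, ⟨hp, p, hpK, rfl⟩, rfl⟩, _, ⟨_, ⟨hq, q, hqK, rfl⟩, rfl⟩, rfl⟩
  refine ⟨hA hp hq ha hb hab, a • p + b • q, hK hpK hqK ha hb hab, ?_⟩
  simp only [vadd_eq_add]
  module

lemma exists_isBounded_image_setOf_inter_vadd_nonempty (hA : Convex ℝ A) (hAo : IsOpen A)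
    (hAne : A.Nonempty) (hB : Convex ℝ B) (hBo : IsOpen B) (hBne : B.Nonempty)
    (hAB : Disjoint A B) (hK : IsBounded K) :
    ∃ f : E →L[ℝ] ℝ, f ≠ 0 ∧
      IsBounded (f '' {x | (A ∩ (x +ᵥ K)).Nonempty ∧ (B ∩ (x +ᵥ K)).Nonempty}) := by
  obtain ⟨f, c, hfA, hfB⟩ := geometric_hahn_banach_open_open hA hAo hB hBo hAB
  have hfK : f '' K ⊆ Icc (sInf (f '' K)) (sSup (f '' K)) :=
    (f.lipschitz.isBounded_image hK).subset_Icc_sInf_sSup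
  refine ⟨f, ?_, (isBounded_Icc (c - sSup (f '' K)) (c - sInf (f '' K))).subset ?_⟩
  · rintro rfl
    obtain ⟨p, hp⟩ := hAne
    obtain ⟨q, hq⟩ := hBne
    exact lt_asymm (hfA p hp) (hfB q hq)
  · rintro _ ⟨x, ⟨⟨_, hp, p, hpK, rfl⟩, ⟨_, hq, q, hqK, rfl⟩⟩, rfl⟩
    have hxp : f x + f p < c := map_add f x p ▸ hfA _ hp
    have hxq : c < f x + f q := map_add f x q ▸ hfB _ hq
    have hp' := hfK (mem_image_of_mem f hpK)
    have hq' := hfK (mem_image_of_mem f hqK)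
    constructor <;> linarith [hp'.1, hq'.2]

lemma exists_nonneg_smul_mem_frontier (hGo : IsOpen G) (hG : 0 ∈ G) {f : E →L[ℝ] ℝ}
    (hbdd : IsBounded (f '' G)) {v : E} (hv : f v ≠ 0) : ∃ t : ℝ, 0 ≤ t ∧ t • v ∈ frontier G := by
  have hray : IsPreconnected ((fun t : ℝ => t • v) '' Ici 0) :=
    isPreconnected_Ici.image _ (by fun_prop)
  obtain ⟨M, hM⟩ := hbdd.exists_norm_le
  have hexit : ((|M| + 1) / |f v|) • v ∉ G := by
    intro hmem
    have hle := hM _ (mem_image_of_mem f hmem)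
    rw [map_smul, norm_smul, Real.norm_eq_abs (f v), Real.norm_of_nonneg (by positivity),
      div_mul_cancel₀ _ (abs_ne_zero.2 hv)] at hle
    linarith [le_abs_self M]
  by_contra! hfrontier
  refine hexit (hray.subset_of_closure_inter_subset hGo
    ⟨0, ⟨0, self_mem_Ici, zero_smul ℝ v⟩, hG⟩ ?_ ⟨_, mem_Ici.2 (by positivity), rfl⟩)
  rintro _ ⟨hclosure, t, ht, rfl⟩
  by_contra hmem
  exact hfrontier t ht (hGo.frontier_eq ▸ ⟨hclosure, hmem⟩)

lemma exists_mem_frontier_zero_mem_segment (hGo : IsOpen G) (hG : 0 ∈ G) {f : E →L[ℝ] ℝ}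
    (hf : f ≠ 0) (hbdd : IsBounded (f '' G)) :
    ∃ x ∈ frontier G, ∃ y ∈ frontier G, (0 : E) ∈ segment ℝ x y := by
  obtain ⟨v, hv⟩ := DFunLike.ne_iff.1 hf
  obtain ⟨s, hs, hsG⟩ := exists_nonneg_smul_mem_frontier hGo hG hbdd hv
  obtain ⟨t, ht, htG⟩ := exists_nonneg_smul_mem_frontier hGo hG hbdd (v := -v)
    (by rwa [map_neg, neg_ne_zero])
  refine ⟨_, hsG, _, htG, mem_segment_iff_sameRay.2 ?_⟩
  rw [zero_sub, sub_zero, ← smul_neg]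
  exact (SameRay.sameRay_nonneg_smul_left (-v) hs).trans
    (SameRay.sameRay_nonneg_smul_right (-v) ht) fun h => Or.inl (by rw [h, smul_zero])

end Slide

section Partition

variable {d n : ℕ} {C K : Set (EuclideanSpace ℝ (Fin d))} {k : ℝ}

lemma IsInductivePartition.isConvexPartition {V : Fin n → Set (EuclideanSpace ℝ (Fin d))}
    (hV : IsInductivePartition n V) : IsConvexPartition V := by
  match n, V, hV with
  | 1, V, hV =>
    have huniv : ∀ i, V i = univ := fun i => Subsingleton.elim i 0 ▸ hV
    exact {
      isClosed := fun i => huniv i ▸ isClosed_univ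
      convex := fun i => huniv i ▸ convex_univ
      interior_nonempty := fun i => by simp [huniv i]
      disjoint_interior := fun i j hij => absurd (Subsingleton.elim i j) hij
      iUnion_eq := by simp only [huniv, iUnion_const] }
  | n + 2, V, hV => exact hV.1

lemma IsConvexPartition.isCompact_inter {V : Fin n → Set (EuclideanSpace ℝ (Fin d))}
    (hV : IsConvexPartition V) (hK : IsCompact K) (i : Fin n) : IsCompact (V i ∩ K) :=
  hK.inter_left (hV.isClosed i)

lemma disjoint_of_disjoint_interior {E : Type*} [AddCommGroup E] [Module ℝ E] [TopologicalSpace E]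
    [IsTopologicalAddGroup E] [ContinuousSMul ℝ E] {U A : Set E} (hU : IsOpen U)
    (hA : Convex ℝ A) (hAint : (interior A).Nonempty) (h : Disjoint U (interior A)) :
    Disjoint U A := by
  have hclosure := h.closure_right hU
  rw [hA.closure_interior_eq_closure_of_nonempty_interior hAint] at hclosure
  exact hclosure.mono_right subset_closure

lemma subset_of_interior_subset {E : Type*} [AddCommGroup E] [Module ℝ E] [TopologicalSpace E]
    [IsTopologicalAddGroup E] [ContinuousSMul ℝ E] {A B : Set E} (hA : Convex ℝ A)
    (hAint : (interior A).Nonempty) (hB : IsClosed B) (h : interior A ⊆ B) : A ⊆ B := by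
  have hclosure := closure_minimal h hB
  rw [hA.closure_interior_eq_closure_of_nonempty_interior hAint] at hclosure
  exact subset_closure.trans hclosure

lemma IsConvexPartition.inter_subset_of_interior_eq_empty
    {V : Fin (n + 1) → Set (EuclideanSpace ℝ (Fin d))} (hV : IsConvexPartition V)
    {W : Fin n → Set (EuclideanSpace ℝ (Fin d))} (hW : IsConvexPartition W) {i : Fin (n + 1)}
    (hVW : ∀ j, V (i.succAbove j) ⊆ W j) (hK : Convex ℝ K) (hi : interior (V i ∩ K) = ∅)
    {j : Fin n} (hj : (interior (W j ∩ K)).Nonempty) : W j ∩ K ⊆ V (i.succAbove j) := by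
  refine subset_of_interior_subset ((hW.convex j).inter hK) hj (hV.isClosed _) ?_
  have hdisj : ∀ l ≠ j, Disjoint (interior (W j ∩ K)) (V (i.succAbove l)) := fun l hl =>
    disjoint_of_disjoint_interior isOpen_interior (hV.convex _) (hV.interior_nonempty _)
      ((hW.disjoint_interior j l hl.symm).mono (interior_mono inter_subset_left)
        (interior_mono (hVW l)))
  have hrest : interior (W j ∩ K) \ V (i.succAbove j) ⊆ V i ∩ K := by
    rintro y ⟨hy, hyV⟩
    refine ⟨?_, (interior_subset hy).2⟩
    obtain ⟨l, hl⟩ := mem_iUnion.1 (hV.iUnion_eq ▸ mem_univ y)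
    induction l using i.succAboveCases with
    | x => exact hl
    | p l =>
      rcases eq_or_ne l j with rfl | hlj
      · exact absurd hl hyV
      · exact absurd hl (disjoint_left.1 (hdisj l hlj) hy)
  exact sdiff_eq_empty.1 (subset_empty_iff.1
    (hi ▸ interior_maximal hrest (isOpen_interior.sdiff (hV.isClosed _))))

lemma IsConvexPartition.exists_slide {V : Fin (n + 2) → Set (EuclideanSpace ℝ (Fin d))}
    (hV : IsConvexPartition V) (hK : IsCompact K) (h : ∀ i, (interior (V i ∩ K)).Nonempty) :
    ∃ x y : EuclideanSpace ℝ (Fin d), 0 ∈ segment ℝ x y ∧ ∀ z ∈ ({x, y} : Set _),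
      (∀ i, (V i ∩ (z +ᵥ K)).Nonempty) ∧ ∃ i, interior (V i ∩ (z +ᵥ K)) = ∅ := by
  set G := {z : EuclideanSpace ℝ (Fin d) | ∀ i, (interior (V i ∩ (z +ᵥ K))).Nonempty}
  have hopen : IsOpen G := by
    simp only [G, ofPred_forall]
    exact isOpen_iInter_of_finite fun i => isOpen_setOf_interior_inter_vadd_nonempty
  have hclosure : closure G ⊆ {z | ∀ i, (V i ∩ (z +ᵥ K)).Nonempty} := by
    refine closure_minimal (fun z hz i => (hz i).mono interior_subset) ?_
    simp only [ofPred_forall]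
    exact isClosed_iInter fun i => isClosed_setOf_inter_vadd_nonempty (hV.isClosed i) hK
  obtain ⟨f, hf, hbdd⟩ := exists_isBounded_image_setOf_inter_vadd_nonempty
    (hV.convex 0).interior isOpen_interior (hV.interior_nonempty 0)
    (hV.convex 1).interior isOpen_interior (hV.interior_nonempty 1)
    (hV.disjoint_interior 0 1 zero_ne_one) hK.isBounded
  have hmeets : ∀ z ∈ G, ∀ i, (interior (V i) ∩ (z +ᵥ K)).Nonempty := fun z hz i =>
    (hz i).mono (interior_inter.subset.trans (inter_subset_inter_right _ interior_subset))
  obtain ⟨x, hx, y, hy, hxy⟩ := exists_mem_frontier_zero_mem_segment hopen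
    (show 0 ∈ G by simpa only [G, mem_ofPred_eq, zero_vadd] using h) hf
    (hbdd.subset (image_mono fun z hz => ⟨hmeets z hz 0, hmeets z hz 1⟩))
  refine ⟨x, y, hxy, fun z hz => ?_⟩
  have hzG : z ∈ closure G \ G := by
    rw [← hopen.frontier_eq]
    rcases hz with rfl | rfl <;> assumption
  refine ⟨hclosure hzG.1, ?_⟩
  simpa only [G, mem_ofPred_eq, not_forall, not_nonempty_iff_eq_empty] using hzG.2

variable [NeZero d] (hC : IsBounded C) (hspan : affineSpan ℝ C = ⊤)
include hC hspan

lemma maxRoundingFactor_le_sum_of_interior_eq_empty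
    {V : Fin (n + 1) → Set (EuclideanSpace ℝ (Fin d))} (hV : IsConvexPartition V)
    {W : Fin n → Set (EuclideanSpace ℝ (Fin d))} (hW : IsConvexPartition W) {i : Fin (n + 1)}
    (hVW : ∀ j, V (i.succAbove j) ⊆ W j) (hK : IsCompact K) (hKconv : Convex ℝ K)
    (hi : interior (V i ∩ K) = ∅)
    (hle : maxRoundingFactor C K k ≤ ∑ j, maxRoundingFactor C (W j ∩ K) k) :
    maxRoundingFactor C K k ≤ ∑ i, maxRoundingFactor C (V i ∩ K) k := by
  rw [Fin.sum_univ_succAbove _ i]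
  refine hle.trans (le_add_of_nonneg_of_le maxRoundingFactor_nonneg
    (Finset.sum_le_sum fun j _ => ?_))
  rcases (interior (W j ∩ K)).eq_empty_or_nonempty with hj | hj
  · rw [maxRoundingFactor_eq_zero hC hspan (hW.isCompact_inter hK j)
      ((hW.convex j).inter hKconv) hj]
    exact maxRoundingFactor_nonneg
  · exact maxRoundingFactor_mono hC hspan (hV.isCompact_inter hK _) (subset_inter
      (hV.inter_subset_of_interior_eq_empty hW hVW hKconv hi hj) inter_subset_right)

lemma maxRoundingFactor_le_sum_of_zero_mem_segment {V : Fin n → Set (EuclideanSpace ℝ (Fin d))}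
    (hV : IsConvexPartition V) (hK : IsCompact K) (hKconv : Convex ℝ K)
    {x y : EuclideanSpace ℝ (Fin d)} (hxy : 0 ∈ segment ℝ x y)
    (h : ∀ z ∈ ({x, y} : Set _), (∀ i, (V i ∩ (z +ᵥ K)).Nonempty) ∧
      maxRoundingFactor C (z +ᵥ K) k ≤ ∑ i, maxRoundingFactor C (V i ∩ (z +ᵥ K)) k) :
    maxRoundingFactor C K k ≤ ∑ i, maxRoundingFactor C (V i ∩ K) k := by
  have hCne := AffineSubspace.nonempty_of_affineSpan_eq_top ℝ _ _ hspan
  obtain ⟨hxne, hxle⟩ := h x (mem_insert x {y})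
  obtain ⟨hyne, hyle⟩ := h y (mem_insert_of_mem x rfl)
  rw [maxRoundingFactor_vadd hCne hK] at hxle hyle
  obtain ⟨a, b, ha, hb, hab, hzero⟩ := hxy
  calc maxRoundingFactor C K k = a * maxRoundingFactor C K k + b * maxRoundingFactor C K k := by
        rw [← add_mul, hab, one_mul]
    _ ≤ a * ∑ i, maxRoundingFactor C (V i ∩ (x +ᵥ K)) k
        + b * ∑ i, maxRoundingFactor C (V i ∩ (y +ᵥ K)) k := by gcongr
    _ = ∑ i, (a * maxRoundingFactor C (V i ∩ (x +ᵥ K)) k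
        + b * maxRoundingFactor C (V i ∩ (y +ᵥ K)) k) := by
      rw [Finset.mul_sum, Finset.mul_sum, Finset.sum_add_distrib]
    _ ≤ ∑ i, maxRoundingFactor C (V i ∩ K) k := by
      gcongr with i
      have hsub := smul_inter_vadd_add_smul_inter_vadd_subset (x := x) (y := y)
        (hV.convex i) hKconv ha hb hab
      rw [hzero, zero_vadd] at hsub
      exact add_le_maxRoundingFactor hC hspan (hV.isCompact_inter (hK.vadd x) i) (hxne i)
        (hV.isCompact_inter (hK.vadd y) i) (hyne i) (hV.isCompact_inter hK i) ha hb hsub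

lemma maxRoundingFactor_le_sum {V : Fin n → Set (EuclideanSpace ℝ (Fin d))}
    (hV : IsInductivePartition n V) (hK : IsCompact K) (hKconv : Convex ℝ K) :
    maxRoundingFactor C K k ≤ ∑ i, maxRoundingFactor C (V i ∩ K) k := by
  induction n using Nat.twoStepInduction generalizing K with
  | zero => exact hV.elim
  | one =>
    have huniv : V 0 = univ := hV
    simp [huniv]
  | more n _ ih =>
    have hdegenerate : ∀ z : EuclideanSpace ℝ (Fin d),
        (∃ i, interior (V i ∩ (z +ᵥ K)) = ∅) →
        maxRoundingFactor C (z +ᵥ K) k ≤ ∑ i, maxRoundingFactor C (V i ∩ (z +ᵥ K)) k := by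
      rintro z ⟨i, hi⟩
      obtain ⟨W, hW, hVW⟩ := hV.2 i
      exact maxRoundingFactor_le_sum_of_interior_eq_empty hC hspan hV.1 hW.isConvexPartition hVW
        (hK.vadd z) (hKconv.vadd z) hi (ih hW (hK.vadd z) (hKconv.vadd z))
    by_cases hnondegenerate : ∀ i, (interior (V i ∩ K)).Nonempty
    · obtain ⟨x, y, hxy, h⟩ := hV.1.exists_slide hK hnondegenerate
      exact maxRoundingFactor_le_sum_of_zero_mem_segment hC hspan hV.1 hK hKconv hxy
        fun z hz => ⟨(h z hz).1, hdegenerate z (h z hz).2⟩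
    · simp only [not_forall, not_nonempty_iff_eq_empty] at hnondegenerate
      simpa only [zero_vadd] using
        hdegenerate 0 (by simpa only [zero_vadd] using hnondegenerate)

end Partition

theorem theorem2p2_general {d : ℕ} [NeZero d] {K C : Set (EuclideanSpace ℝ (Fin d))}
    (hK : IsConvexBody K) (hC : IsBounded C) (hspan : affineSpan ℝ C = ⊤) {m : ℕ} (hm : 1 ≤ m)
    {n : ℕ} {V : Fin n → Set (EuclideanSpace ℝ (Fin d))} (hV : IsInductivePartition n V)
    (hVK : ∀ i, (interior (V i ∩ K)).Nonempty) :
    (∃! ρ : ℝ, IsSuccessiveInradius C K m ρ) ∧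
    (∀ i, ∃! ρ : ℝ, IsSuccessiveInradius C (V i ∩ K) m ρ) ∧
    successiveInradius C K m ≤ ∑ i, successiveInradius C (V i ∩ K) m := by
  have hbody : ∀ i, IsConvexBody (V i ∩ K) := fun i =>
    ⟨(hV.isConvexPartition.convex i).inter hK.convex,
      hV.isConvexPartition.isCompact_inter hK.isCompact i, hVK i⟩
  refine ⟨existsUnique_isSuccessiveInradius hC hspan hK hm,
    fun i => existsUnique_isSuccessiveInradius hC hspan (hbody i) hm, ?_⟩
  simp only [successiveInradius_eq_maxRoundingFactor hC hspan hK hm,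
    fun i => successiveInradius_eq_maxRoundingFactor hC hspan (hbody i) hm]
  exact maxRoundingFactor_le_sum hC hspan hV hK.isCompact hK.convex

end SuccessiveInradii

theorem theorem2p2 (d : ℕ) (hd : 2 ≤ d) (K C : Set (EuclideanSpace ℝ (Fin d)))
    (hK : IsConvexBody K) (hC : IsConvexBody C) (m : ℕ) (hm : 1 ≤ m)
    (n : ℕ) (V : Fin n → Set (EuclideanSpace ℝ (Fin d))) (hV : IsInductivePartition n V)
    (hVK : ∀ i, (interior (V i ∩ K)).Nonempty) :
    (∃! ρ : ℝ, IsSuccessiveInradius C K m ρ) ∧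
    (∀ i, ∃! ρ : ℝ, IsSuccessiveInradius C (V i ∩ K) m ρ) ∧
    successiveInradius C K m ≤ ∑ i, successiveInradius C (V i ∩ K) m := by
  have : NeZero d := ⟨by lia⟩
  exact theorem2p2_general hK hC.isCompact.isBounded
    (hC.convex.interior_nonempty_iff_affineSpan_eq_top.1 hC.interior_nonempty) hm hV hVK
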